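/- Let $p \ge 1$ and $q \ge 0$ be fixed integers, let $d = p+q \ge 2$, and let $\mathbf{I}_{p,q} = \operatorname{diag}(1,\dots,1,-1,\dots,-1)$ with $p$ ones and $q$ minus ones. For $\mathbf{X} \in \mathbb{R}^{n\times d}$ put $\mathbf{P}_{\mathbf{X}} = \mathbf{X}\mathbf{I}_{p,q}\mathbf{X}^T$, and let $\mathcal{X}_n^{(p,q)}$ be the set of all $\mathbf{X} \in \mathbb{R}^{n\times d}$ for which every entry of $\mathbf{P}_{\mathbf{X}}$ lies in $[0,1]$. Under the (conditional) generalized random dot product graph (GRDPG) with latent positions $\mathbf{X} \in \mathcal{X}_n^{(p,q)}$, one observes a symmetric adjacency matrix $\mathbf{A} \in \{0,1\}^{n\times n}$ with zero diagonal whose entries $\mathbf{A}_{ij} \sim \operatorname{Bern}((\mathbf{P}_{\mathbf{X}})_{ij})$, $1 \le i < j \le n$, are independent. Let $\mathbb{O}_d$ be the group of $d \times d$ orthogonal matrices and $\mathbb{O}_{p,q} = \{\mathbf{Q} \in \mathbb{R}^{d\times d} : \mathbf{Q}\mathbf{I}_{p,q}\mathbf{Q}^T = \mathbf{I}_{p,q}\}$.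 Write $\mathbf{X} \sim \mathbf{Y}$ if $\mathbf{Y} = \mathbf{X}\mathbf{Q}$ for some $\mathbf{Q} \in \mathbb{O}_{p,q}$, and let $[\mathbf{X}]$ be the class of $\mathbf{X}$. Decompose $\mathbf{P}_{\mathbf{X}} = \mathbf{U}_{\mathbf{X}}\boldsymbol{\Lambda}_{\mathbf{X}}^{1/2}\mathbf{I}_{p,q}\boldsymbol{\Lambda}_{\mathbf{X}}^{1/2}\mathbf{U}_{\mathbf{X}}^T$, where $\mathbf{U}_{\mathbf{X}} \in \mathbb{R}^{n \times d}$ has orthonormal columns and $\boldsymbol{\Lambda}_{\mathbf{X}}$ is diagonal with non-negative entries, and define $$\tilde d_{2,\infty}([\mathbf{X}],[\mathbf{Y}]) = \min_{\mathbf{W} \in \mathbb{O}_d \cap \mathbb{O}_{p,q}} \left\| \mathbf{U}_{\mathbf{X}}\boldsymbol{\Lambda}_{\mathbf{X}}^{1/2} - \mathbf{U}_{\mathbf{Y}}\boldsymbol{\Lambda}_{\mathbf{Y}}^{1/2}\mathbf{W} \right\|_{2,\infty},$$ where $\|\mathbf{M}\|_{2,\infty}$ is the largest Euclidean norm of a row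 of $\mathbf{M}$. Let $\lambda_k(\mathbf{P})$ be the $k$-th largest absolute value of an eigenvalue of the symmetric matrix $\mathbf{P}$, counted with multiplicity, and $\kappa(\mathbf{P}) = \lambda_1(\mathbf{P})/\lambda_d(\mathbf{P})$. Let $K \ge 2d$ be a constant. Then there are $c > 0$ and $N$, depending only on $p$, $q$ and $K$, such that for all $n \ge N$ and all $\lambda_\star > 0$ with $6 d \lambda_\star \le n$, $$\inf_{\hat{\mathbf{X}}}\ \sup_{\substack{\mathbf{X} \in \mathcal{X}_n^{(p,q)} \\ 2d \le \kappa(\mathbf{P}_{\mathbf{X}}) \le K,\ \lambda_d(\mathbf{P}_{\mathbf{X}}) \ge \lambda_\star}} \mathbb{E}\, \tilde d_{2,\infty}([\hat{\mathbf{X}}],[\mathbf{X}]) \ \ge\ c \sqrt{\frac{\lambda_\star \wedge \log n}{n}},$$ where the infimum is over all estimators $\hat{\mathbf{X}} = \hat{\mathbf{X}}(\mathbf{A}) \in \mathbb{R}^{n\times d}$. -/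

import Mathlib

namespace GRDPG

/-- The signature matrix `I_{p,q} = diag(1, …, 1, -1, …, -1)` with `p` ones and `q` minus ones. -/
def signature (p q : ℕ) : Matrix (Fin p ⊕ Fin q) (Fin p ⊕ Fin q) ℝ :=
  Matrix.diagonal (Sum.elim (fun _ => 1) (fun _ => -1))

/-- The indefinite orthogonal group `O_{p,q} = {Q : Q I_{p,q} Qᵀ = I_{p,q}}`. -/
def indefOrthogonal (p q : ℕ) : Set (Matrix (Fin p ⊕ Fin q) (Fin p ⊕ Fin q) ℝ) :=
  {Q | Q * signature p q * Q.transpose = signature p q}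

/-- The matrix `P_X = X I_{p,q} Xᵀ` of edge probabilities. -/
def probMatrix {n p q : ℕ} (X : Matrix (Fin n) (Fin p ⊕ Fin q) ℝ) : Matrix (Fin n) (Fin n) ℝ :=
  X * signature p q * X.transpose

/-- The set `𝒳_n^{(p,q)}` of latent position matrices: all entries of `X I_{p,q} Xᵀ` lie
in `[0,1]`. -/
def latentPositions (n p q : ℕ) : Set (Matrix (Fin n) (Fin p ⊕ Fin q) ℝ) :=
  {X | ∀ i j, 0 ≤ probMatrix X i j ∧ probMatrix X i j ≤ 1}

/-! ### The equivalence relation on latent positions -/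

theorem signature_mul_self (p q : ℕ) : signature p q * signature p q = 1 := by
  rw [signature, Matrix.diagonal_mul_diagonal, ← Matrix.diagonal_one]
  congr 1
  funext k
  rcases k with k | k <;> simp

theorem indefOrthogonal_one (p q : ℕ) : (1 : Matrix _ _ ℝ) ∈ indefOrthogonal p q := by
  simp [indefOrthogonal]

theorem indefOrthogonal_mul {p q : ℕ} {Q R : Matrix (Fin p ⊕ Fin q) (Fin p ⊕ Fin q) ℝ}
    (hQ : Q ∈ indefOrthogonal p q) (hR : R ∈ indefOrthogonal p q) :
    Q * R ∈ indefOrthogonal p q := by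
  simp only [indefOrthogonal, Set.mem_ofPred_eq] at *
  calc Q * R * signature p q * (Q * R).transpose
      = Q * (R * signature p q * R.transpose) * Q.transpose := by
        rw [Matrix.transpose_mul]; simp only [Matrix.mul_assoc]
    _ = signature p q := by rw [hR, hQ]

theorem indefOrthogonal_inv {p q : ℕ} {Q : Matrix (Fin p ⊕ Fin q) (Fin p ⊕ Fin q) ℝ}
    (hQ : Q ∈ indefOrthogonal p q) : ∃ R ∈ indefOrthogonal p q, Q * R = 1 := by
  simp only [indefOrthogonal, Set.mem_ofPred_eq] at *
  have h1 : Q * (signature p q * Q.transpose * signature p q) = 1 := by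
    rw [← signature_mul_self p q, ← Matrix.mul_assoc, ← Matrix.mul_assoc, hQ]
  refine ⟨_, ?_, h1⟩
  set R := signature p q * Q.transpose * signature p q with hR
  have h2 : R * Q = 1 := mul_eq_one_comm.mp h1
  have h3 : Q.transpose * R.transpose = 1 := by
    rw [← Matrix.transpose_mul, h2, Matrix.transpose_one]
  calc R * signature p q * R.transpose
      = R * (Q * signature p q * Q.transpose) * R.transpose := by rw [hQ]
    _ = (R * Q) * signature p q * (Q.transpose * R.transpose) := by
        simp only [Matrix.mul_assoc]
    _ = signature p q := by rw [h2, h3]; simp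

/-- `X ∼ Y` if and only if `Y = X Q` for some `Q ∈ O_{p,q}`. The relation is defined on all
`n × (p+q)` matrices, so that an estimate need not be an element of `𝒳_n^{(p,q)}` to have a class;
`𝒳_n^{(p,q)}` is a union of equivalence classes. -/
def latentSetoid (n p q : ℕ) : Setoid (Matrix (Fin n) (Fin p ⊕ Fin q) ℝ) where
  r X Y := ∃ Q ∈ indefOrthogonal p q, Y = X * Q
  iseqv :=
    { refl := fun X => ⟨1, indefOrthogonal_one p q, by simp⟩
      symm := by
        rintro X Y ⟨Q, hQ, rfl⟩
        obtain ⟨R, hR, hQR⟩ := indefOrthogonal_inv hQ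
        exact ⟨R, hR, by rw [Matrix.mul_assoc, hQR, Matrix.mul_one]⟩
      trans := by
        rintro X Y Z ⟨Q, hQ, rfl⟩ ⟨R, hR, rfl⟩
        exact ⟨Q * R, indefOrthogonal_mul hQ hR, by rw [Matrix.mul_assoc]⟩ }

/-- The equivalence class `[X]` of a latent position matrix. -/
def latentClass {n p q : ℕ} (X : Matrix (Fin n) (Fin p ⊕ Fin q) ℝ) :
    Quotient (latentSetoid n p q) :=
  Quotient.mk (latentSetoid n p q) X

theorem probMatrix_eq_of_rel {n p q : ℕ} {X Y : Matrix (Fin n) (Fin p ⊕ Fin q) ℝ}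
    (h : (latentSetoid n p q).r X Y) : probMatrix X = probMatrix Y := by
  obtain ⟨Q, hQ, rfl⟩ := h
  have hQ' : Q * signature p q * Q.transpose = signature p q := hQ
  calc X * signature p q * X.transpose
      = X * (Q * signature p q * Q.transpose) * X.transpose := by rw [hQ']
    _ = X * Q * signature p q * (X * Q).transpose := by
        rw [Matrix.transpose_mul]; simp only [Matrix.mul_assoc]

/-! ### The spectral representative `U_X Λ_X^{1/2}` of a class -/

/-- `Z = U Λ^{1/2}` for a matrix `U` with orthonormal columns and a diagonal matrix `Λ ≥ 0`
(that is, the columns of `Z` are pairwise orthogonal), and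
`P = U Λ^{1/2} I_{p,q} Λ^{1/2} Uᵀ = Z I_{p,q} Zᵀ`. -/
def IsSpectralFactor {n p q : ℕ} (P : Matrix (Fin n) (Fin n) ℝ)
    (Z : Matrix (Fin n) (Fin p ⊕ Fin q) ℝ) : Prop :=
  P = Z * signature p q * Z.transpose ∧ (Z.transpose * Z).IsDiag

theorem signature_form_apply {n p q : ℕ} (Z : Matrix (Fin n) (Fin p ⊕ Fin q) ℝ) (i j : Fin n) :
    (Z * signature p q * Z.transpose) i j
      = ∑ k, Z i k * Sum.elim (fun _ => (1 : ℝ)) (fun _ => -1) k * Z j k := by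
  rw [Matrix.mul_apply]
  simp only [signature, Matrix.mul_diagonal, Matrix.transpose_apply]

/-- If `A Aᵀ - B Bᵀ` is diagonal, then it has at most as many positive diagonal entries as `A`
has columns. -/
theorem card_pos_le {n p q : ℕ} (A : Matrix (Fin n) (Fin p) ℝ) (B : Matrix (Fin n) (Fin q) ℝ)
    (μ : Fin n → ℝ) (h : A * A.transpose - B * B.transpose = Matrix.diagonal μ) :
    Fintype.card {i // 0 < μ i} ≤ p := by
  have hli : LinearIndependent ℝ (fun (i : {i // 0 < μ i}) => A i.1) := by
    rw [Fintype.linearIndependent_iff]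
    intro c hc
    set A' : Matrix {i // 0 < μ i} (Fin p) ℝ := A.submatrix (fun i => i.1) id with hA'
    set B' : Matrix {i // 0 < μ i} (Fin q) ℝ := B.submatrix (fun i => i.1) id with hB'
    have h' : A' * A'.transpose - B' * B'.transpose
        = Matrix.diagonal (fun i : {i // 0 < μ i} => μ i.1) := by
      ext i j
      have := congrFun (congrFun h i.1) j.1
      simpa [Matrix.mul_apply, Matrix.diagonal_apply, hA', hB', Subtype.ext_iff] using this
    have hcA : Matrix.vecMul c A' = 0 := by
      rw [← hc]
      ext k
      simp [Matrix.vecMul, dotProduct, hA']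
    have e1 : dotProduct (Matrix.vecMul c (A' * A'.transpose - B' * B'.transpose)) c
        = - dotProduct (Matrix.vecMul c B') (Matrix.vecMul c B') := by
      rw [Matrix.vecMul_sub, ← Matrix.vecMul_vecMul, hcA, Matrix.zero_vecMul, zero_sub,
        neg_dotProduct, ← Matrix.vecMul_vecMul, Matrix.vecMul_transpose,
        dotProduct_comm, Matrix.dotProduct_mulVec]
    have e2 : dotProduct (Matrix.vecMul c (A' * A'.transpose - B' * B'.transpose)) c
        = ∑ i, c i ^ 2 * μ i.1 := by
      rw [h', dotProduct]
      refine Finset.sum_congr rfl fun i _ => ?_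
      rw [Matrix.vecMul_diagonal]
      ring
    have e3 : 0 ≤ dotProduct (Matrix.vecMul c B') (Matrix.vecMul c B') :=
      Finset.sum_nonneg fun i _ => mul_self_nonneg _
    have e4 : ∀ i ∈ (Finset.univ : Finset {i // 0 < μ i}), 0 ≤ c i ^ 2 * μ i.1 :=
      fun i _ => mul_nonneg (sq_nonneg _) i.2.le
    have e5 : ∑ i, c i ^ 2 * μ i.1 = 0 :=
      le_antisymm (by linarith) (Finset.sum_nonneg e4)
    intro i
    have e6 := (Finset.sum_eq_zero_iff_of_nonneg e4).mp e5 i (Finset.mem_univ i)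
    have := i.2.ne'
    simpa [this] using e6
  simpa using hli.fintype_card_le_finrank

/-- Every `X I_{p,q} Xᵀ` has a spectral factor. -/
theorem exists_isSpectralFactor {n p q : ℕ} (X : Matrix (Fin n) (Fin p ⊕ Fin q) ℝ) :
    ∃ Z : Matrix (Fin n) (Fin p ⊕ Fin q) ℝ, IsSpectralFactor (probMatrix X) Z := by
  have hP : (probMatrix X).IsHermitian := by
    rw [Matrix.IsHermitian, Matrix.conjTranspose_eq_transpose_of_trivial]
    simp [probMatrix, signature, Matrix.transpose_mul, Matrix.mul_assoc]
  set μ := hP.eigenvalues with hμ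
  set V : Matrix (Fin n) (Fin n) ℝ := hP.eigenvectorUnitary.1 with hV
  have hVV : V.transpose * V = 1 := by
    have := Unitary.coe_star_mul_self hP.eigenvectorUnitary
    rwa [Matrix.star_eq_conjTranspose, Matrix.conjTranspose_eq_transpose_of_trivial] at this
  have hVV' : V * V.transpose = 1 := mul_eq_one_comm.mp hVV
  have hspec : probMatrix X = V * Matrix.diagonal μ * V.transpose := by
    have := hP.spectral_theorem
    rw [Unitary.conjStarAlgAut_apply, Matrix.star_eq_conjTranspose,
      Matrix.conjTranspose_eq_transpose_of_trivial] at this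
    simpa using this
  have hY : (V.transpose * X) * signature p q * (V.transpose * X).transpose
      = Matrix.diagonal μ := by
    calc (V.transpose * X) * signature p q * (V.transpose * X).transpose
        = V.transpose * probMatrix X * V := by
          rw [Matrix.transpose_mul, Matrix.transpose_transpose, probMatrix]
          simp only [Matrix.mul_assoc]
      _ = (V.transpose * V) * Matrix.diagonal μ * (V.transpose * V) := by
          rw [hspec]; simp only [Matrix.mul_assoc]
      _ = Matrix.diagonal μ := by rw [hVV]; simp
  set Y := V.transpose * X with hYdef
  set A : Matrix (Fin n) (Fin p) ℝ := Y.submatrix id Sum.inl with hA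
  set B : Matrix (Fin n) (Fin q) ℝ := Y.submatrix id Sum.inr with hB
  have hAB : A * A.transpose - B * B.transpose = Matrix.diagonal μ := by
    rw [← hY]
    ext i j
    rw [signature_form_apply]
    simp [Matrix.mul_apply, hA, hB, sub_eq_add_neg]
  have hBA : B * B.transpose - A * A.transpose = Matrix.diagonal (fun i => - μ i) := by
    rw [← neg_sub, hAB]
    ext i j
    by_cases h : i = j <;> simp [h]
  obtain ⟨f⟩ : Nonempty ({i // 0 < μ i} ↪ Fin p) :=
    Function.Embedding.nonempty_of_card_le (by simpa using card_pos_le A B μ hAB)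
  obtain ⟨g⟩ : Nonempty ({i // 0 < - μ i} ↪ Fin q) :=
    Function.Embedding.nonempty_of_card_le (by simpa using card_pos_le B A _ hBA)
  let e : Fin n → Option (Fin p ⊕ Fin q) := fun i =>
    if h : 0 < μ i then some (Sum.inl (f ⟨i, h⟩))
    else if h : 0 < - μ i then some (Sum.inr (g ⟨i, h⟩)) else none
  have he_inj : ∀ i j k, e i = some k → e j = some k → i = j := by
    intro i j k hi hj
    simp only [e] at hi hj
    split_ifs at hi hj with h1 h2 h3 h4 h5 h6
    all_goals
      rw [← hj] at hi
      simp at hi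
    · exact hi
    · exact hi
  let s : Fin p ⊕ Fin q → ℝ := Sum.elim (fun _ => 1) (fun _ => -1)
  have he_some : ∀ i k, e i = some k → s k * |μ i| = μ i := by
    intro i k hi
    simp only [e] at hi
    split_ifs at hi with h1 h2
    · obtain rfl := Option.some.inj hi
      simp [s, abs_of_pos h1]
    · obtain rfl := Option.some.inj hi
      have : μ i < 0 := by linarith
      simp [s, abs_of_neg this]
  have he_none : ∀ i, e i = none → μ i = 0 := by
    intro i hi
    simp only [e] at hi
    split_ifs at hi with h1 h2
    linarith
  let D : Matrix (Fin n) (Fin p ⊕ Fin q) ℝ :=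
    fun i k => if e i = some k then Real.sqrt |μ i| else 0
  have hD1 : D * signature p q * D.transpose = Matrix.diagonal μ := by
    ext i j
    have : (D * signature p q * D.transpose) i j = ∑ k, D i k * s k * D j k :=
      signature_form_apply D i j
    rw [this, Matrix.diagonal_apply]
    split_ifs with hij
    · subst hij
      rcases hei : e i with _ | k
      · simp [D, hei, he_none i hei]
      · rw [Finset.sum_eq_single k]
        · simp only [D, hei, if_true]
          calc Real.sqrt |μ i| * s k * Real.sqrt |μ i|
              = s k * (Real.sqrt |μ i| * Real.sqrt |μ i|) := by ring
            _ = μ i := by rw [Real.mul_self_sqrt (abs_nonneg _), he_some i k hei]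
        · intro l _ hl
          have : ¬ (some k = some l) := fun h => hl (Option.some.inj h).symm
          simp [D, hei, hl.symm]
        · simp
    · refine Finset.sum_eq_zero fun k _ => ?_
      by_cases hi : e i = some k
      · have hj : e j ≠ some k := fun hj => hij (he_inj i j k hi hj)
        simp [D, hj]
      · simp [D, hi]
  have hD2 : (D.transpose * D).IsDiag := by
    intro k l hkl
    rw [Matrix.mul_apply]
    simp only [Matrix.transpose_apply]
    refine Finset.sum_eq_zero fun i _ => ?_
    by_cases hi : e i = some k
    · simp [D, hi, hkl]
    · simp [D, hi]
  refine ⟨V * D, ?_, ?_⟩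
  · rw [hspec, ← hD1, Matrix.transpose_mul]
    simp only [Matrix.mul_assoc]
  · have : (V * D).transpose * (V * D) = D.transpose * D := by
      rw [Matrix.transpose_mul]
      calc D.transpose * V.transpose * (V * D)
          = D.transpose * (V.transpose * V) * D := by simp only [Matrix.mul_assoc]
        _ = D.transpose * D := by rw [hVV, Matrix.mul_one]
    rwa [this]

/-- The representative `U_X Λ_X^{1/2}` of the class of `X`. The choice of the
decomposition is immaterial below: two spectral factors of the same matrix differ by an element of
`O_d ∩ O_{p,q}`. -/
noncomputable def spectralRep {n p q : ℕ} (X : Matrix (Fin n) (Fin p ⊕ Fin q) ℝ) :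
    Matrix (Fin n) (Fin p ⊕ Fin q) ℝ :=
  Classical.choose (exists_isSpectralFactor X)

theorem spectralRep_spec {n p q : ℕ} (X : Matrix (Fin n) (Fin p ⊕ Fin q) ℝ) :
    IsSpectralFactor (probMatrix X) (spectralRep X) :=
  Classical.choose_spec (exists_isSpectralFactor X)

theorem spectralRep_eq_of_rel {n p q : ℕ} {X Y : Matrix (Fin n) (Fin p ⊕ Fin q) ℝ}
    (h : (latentSetoid n p q).r X Y) : spectralRep X = spectralRep Y := by
  have hXY := probMatrix_eq_of_rel h
  unfold spectralRep
  congr 1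
  rw [hXY]

/-! ### The distance on equivalence classes -/

/-- The two-to-infinity norm: the largest Euclidean norm of a row. -/
noncomputable def twoInftyNorm {n p q : ℕ} (M : Matrix (Fin n) (Fin p ⊕ Fin q) ℝ) : ℝ :=
  ⨆ i, Real.sqrt (∑ k, M i k ^ 2)

/-- The group `O_d ∩ O_{p,q}`, where `d = p + q`. -/
def orthoGroup (p q : ℕ) : Set (Matrix (Fin p ⊕ Fin q) (Fin p ⊕ Fin q) ℝ) :=
  {W | W ∈ Matrix.orthogonalGroup (Fin p ⊕ Fin q) ℝ ∧ W ∈ indefOrthogonal p q}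

/-- `d̃_{2,∞}([X], [Y])`, the minimum over `W ∈ O_d ∩ O_{p,q}` of
`‖U_X Λ_X^{1/2} - U_Y Λ_Y^{1/2} W‖_{2,∞}`. -/
noncomputable def latentDist {n p q : ℕ} (x y : Quotient (latentSetoid n p q)) : ℝ :=
  Quotient.liftOn₂ x y
    (fun X Y => ⨅ W : orthoGroup p q, twoInftyNorm (spectralRep X - spectralRep Y * W.1))
    (fun X Y X' Y' hX hY => by
      rw [spectralRep_eq_of_rel hX, spectralRep_eq_of_rel hY])

/-! ### The spectrum of the probability matrix -/

/-- The `k`-th largest absolute value of an eigenvalue of the symmetric matrix `P`, counted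
with multiplicity, for `k = 1, 2, …, n`. -/
noncomputable def absEigenvalue {n : ℕ} (P : Matrix (Fin n) (Fin n) ℝ) (k : ℕ) : ℝ :=
  ((P.charpoly.roots.map (fun x => |x|)).sort (fun a b => a ≥ b)).getD (k - 1) 0

/-- The condition number `κ = λ₁ / λ_d` of a probability matrix of rank `d`. -/
noncomputable def condNumber {n : ℕ} (d : ℕ) (P : Matrix (Fin n) (Fin n) ℝ) : ℝ :=
  absEigenvalue P 1 / absEigenvalue P d

/-- The latent position matrices `X ∈ 𝒳_n^{(p,q)}` with `2d ≤ κ(X I_{p,q} Xᵀ) ≤ K` and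
`λ_d(X I_{p,q} Xᵀ) ≥ lam`, where `d = p + q`. -/
def parameterClass (n p q : ℕ) (K lam : ℝ) : Set (Matrix (Fin n) (Fin p ⊕ Fin q) ℝ) :=
  {X | X ∈ latentPositions n p q ∧
    2 * ((p + q : ℕ) : ℝ) ≤ condNumber (p + q) (probMatrix X) ∧
    condNumber (p + q) (probMatrix X) ≤ K ∧
    lam ≤ absEigenvalue (probMatrix X) (p + q)}

/-! ### The random graph and the minimax risk -/

/-- The pairs `i < j` of vertices. -/
abbrev Pairs (n : ℕ) : Type := {e : Fin n × Fin n // e.1 < e.2}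

/-- The symmetric adjacency matrix with entries in `{0,1}` and zero diagonal whose entries above
the diagonal are `a`. -/
def adjacency {n : ℕ} (a : Pairs n → Bool) : Matrix (Fin n) (Fin n) ℕ := fun i j =>
  if h : i < j then (a ⟨(i, j), h⟩).toNat
  else if h : j < i then (a ⟨(j, i), h⟩).toNat
  else 0

/-- The probability of the outcome `a` when the entries `A_{ij} ∼ Bern(P_{ij})`, `i < j`,
are independent. -/
noncomputable def graphProb {n : ℕ} (P : Matrix (Fin n) (Fin n) ℝ) (a : Pairs n → Bool) : ℝ :=
  ∏ e : Pairs n, if a e then P e.1.1 e.1.2 else 1 - P e.1.1 e.1.2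

/-- The expectation of `f(A)` for `A ∼ GRDPG(X, p, q)`. -/
noncomputable def graphExpectation {n p q : ℕ} (X : Matrix (Fin n) (Fin p ⊕ Fin q) ℝ)
    (f : Matrix (Fin n) (Fin n) ℕ → ℝ) : ℝ :=
  ∑ a : Pairs n → Bool, graphProb (probMatrix X) a * f (adjacency a)

/-- The minimax risk over a set `S` of latent position matrices: the infimum over all estimators
`A ↦ Xhat A` of the supremum over `X ∈ S` of `E d̃_{2,∞}([Xhat A], [X])`. -/
noncomputable def minimaxRisk {n p q : ℕ} (S : Set (Matrix (Fin n) (Fin p ⊕ Fin q) ℝ)) :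
    ENNReal :=
  ⨅ Xhat : Matrix (Fin n) (Fin n) ℕ → Matrix (Fin n) (Fin p ⊕ Fin q) ℝ,
    ⨆ X ∈ S, ENNReal.ofReal
      (graphExpectation X fun A => latentDist (latentClass (Xhat A)) (latentClass X))

end GRDPG

namespace GRDPG

/-! Since `min lam (log n) ≤ log n`, the rate `√(log n / n)` is proved for every `lam`. The
parameter class shrinks as `lam` grows, so it suffices to exhibit hard positions with `λ_d = n /
(4d)`, which exceeds every admissible `lam`.

The hard positions have pairwise orthogonal columns. One positive-signature column is constant,
equal to `√(1/2)`; it puts all edge probabilities near `1/2` and carries the eigenvalue `n / 2`.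
Every other column is `±t k` on a block of its own, with squared norm `n / (4d)`, so that the
condition number is exactly `2d`. The block of the constant column is otherwise empty, and
hypothesis `a` out of `m ≈ n / (2d)` hides a pair of entries `±δ` there, in column `k₂`.

Hiding: with `δ² = log n / (64 n)`, each hypothesis has chi-square affinity at most `√n` to the
common reference without hidden pair (`sum_graphProb_sq_div_le`,
`probMatrix_hardPositions_sub_sq_le`). As `4√n ≤ m`, no test can single out the true hypothesis
(`exists_large_risk`).

Separation: spectral factors are not unique, and the estimate is arbitrary. However, the distances
between two rows, weighted by the squared column norms, depend on `P` alone
(`IsSpectralFactor.sum_sq_rows`), and these norms are at most `n`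
(`IsSpectralFactor.sum_sq_col_le`). Hence the vertex carrying the hidden entry stays at distance of
order `δ` from an empty vertex in every spectral factor, whereas under any other hypothesis the two
rows coincide. One estimate cannot be close to both (`latentDist_separation`). -/

/-- The diagonal of the signature matrix. -/
def sgn {p q : ℕ} : Fin p ⊕ Fin q → ℝ := Sum.elim (fun _ => 1) (fun _ => -1)

theorem sgn_mul_self {p q : ℕ} (k : Fin p ⊕ Fin q) : sgn k * sgn k = 1 := by
  rcases k with k | k <;> simp [sgn]

theorem sgn_sq {p q : ℕ} (k : Fin p ⊕ Fin q) : sgn k ^ 2 = 1 := by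
  rw [sq, sgn_mul_self]

theorem abs_sgn {p q : ℕ} (k : Fin p ⊕ Fin q) : |sgn k| = 1 := by
  rcases k with k | k <;> simp [sgn]

theorem signature_eq (p q : ℕ) : signature p q = Matrix.diagonal sgn := rfl

theorem probMatrix_apply {n p q : ℕ} (X : Matrix (Fin n) (Fin p ⊕ Fin q) ℝ) (i j : Fin n) :
    probMatrix X i j = ∑ k, X i k * sgn k * X j k :=
  signature_form_apply X i j

/-! ### Testing many hypotheses against a common reference -/

/-- If at each outcome at most one of several nonnegative losses is below `ε`, and the
distributions are close in chi-square sense to a common one, then some expected loss is at least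
`ε / 2`. -/
theorem exists_large_risk {Ω : Type*} [Fintype Ω] {m : ℕ} (hm : 0 < m) (μ : Ω → ℝ)
    (hμ : ∀ ω, 0 < μ ω) (hμ1 : ∑ ω, μ ω = 1) (ν : Fin m → Ω → ℝ) (hν : ∀ a ω, 0 ≤ ν a ω)
    (hν1 : ∀ a, ∑ ω, ν a ω = 1) {B : ℝ} (hB : ∀ a, ∑ ω, ν a ω ^ 2 / μ ω ≤ B)
    (hmB : 4 * B ≤ m) (g : Fin m → Ω → ℝ) (hg : ∀ a ω, 0 ≤ g a ω) {ε : ℝ} (hε : 0 < ε)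
    (hsep : ∀ a b, a ≠ b → ∀ ω, g a ω < ε → g b ω < ε → False) :
    ∃ a, ε / 2 ≤ ∑ ω, ν a ω * g a ω := by
  classical
  by_contra! hcon
  set E : Fin m → Ω → ℝ := fun a ω => if g a ω < ε then 1 else 0 with hE
  -- Markov's inequality: an expected loss below `ε / 2` forces the event `g a < ε` to have
  -- probability above one half.
  have hmass : ∀ a, 1 / 2 < ∑ ω, ν a ω * E a ω := by
    intro a
    have h1 : ε * ∑ ω, ν a ω * (1 - E a ω) ≤ ∑ ω, ν a ω * g a ω := by
      rw [Finset.mul_sum]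
      refine Finset.sum_le_sum fun ω _ => ?_
      have := hν a ω
      by_cases h : g a ω < ε
      · simpa [hE, h] using mul_nonneg this (hg a ω)
      · simp only [hE, h, if_false, sub_zero, mul_one]
        rw [mul_comm]
        exact mul_le_mul_of_nonneg_left (not_lt.mp h) this
    have h2 : ∑ ω, ν a ω * (1 - E a ω) = 1 - ∑ ω, ν a ω * E a ω := by
      conv_rhs => rw [← hν1 a, ← Finset.sum_sub_distrib]
      exact Finset.sum_congr rfl fun ω _ => by ring
    have h3 := hcon a
    rw [h2] at h1
    by_contra h4
    nlinarith
  have hdisj : ∀ ω, ∑ a, E a ω ≤ 1 := by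
    intro ω
    by_cases h : ∃ a, g a ω < ε
    · obtain ⟨a, ha⟩ := h
      rw [Finset.sum_eq_single a]
      · simp [hE, ha]
      · intro b _ hb
        have : ¬ g b ω < ε := fun h' => hsep b a hb ω h' ha
        simp [hE, this]
      · simp
    · push Not at h
      rw [Finset.sum_eq_zero]
      · exact zero_le_one
      · intro a _
        simp [hE, not_lt.mpr (h a)]
  have hEE : ∀ a ω, E a ω ^ 2 = E a ω := by
    intro a ω
    by_cases h : g a ω < ε <;> simp [hE, h]
  -- Cauchy–Schwarz over hypotheses and outcomes jointly. The second factor is the total `μ`-mass of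
  -- the disjoint events, hence at most 1, so `(m / 2)² < m * B`, against `4 * B ≤ m`.
  have hCS : (∑ x : Fin m × Ω, (ν x.1 x.2 / √(μ x.2)) * (√(μ x.2) * E x.1 x.2)) ^ 2
      ≤ (∑ x : Fin m × Ω, (ν x.1 x.2 / √(μ x.2)) ^ 2)
        * ∑ x : Fin m × Ω, (√(μ x.2) * E x.1 x.2) ^ 2 :=
    Finset.sum_mul_sq_le_sq_mul_sq _ _ _
  have e1 : (∑ x : Fin m × Ω, (ν x.1 x.2 / √(μ x.2)) * (√(μ x.2) * E x.1 x.2))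
      = ∑ a, ∑ ω, ν a ω * E a ω := by
    rw [Fintype.sum_prod_type]
    refine Finset.sum_congr rfl fun a _ => Finset.sum_congr rfl fun ω _ => ?_
    have := (Real.sqrt_pos.mpr (hμ ω)).ne'
    field_simp
  have e2 : (∑ x : Fin m × Ω, (ν x.1 x.2 / √(μ x.2)) ^ 2) ≤ m * B := by
    rw [Fintype.sum_prod_type]
    calc ∑ a, ∑ ω, (ν a ω / √(μ ω)) ^ 2 ≤ ∑ _a : Fin m, B := by
          refine Finset.sum_le_sum fun a _ => (le_of_eq ?_).trans (hB a)
          refine Finset.sum_congr rfl fun ω _ => ?_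
          rw [div_pow, Real.sq_sqrt (hμ ω).le]
      _ = m * B := by simp
  have e3 : ∑ x : Fin m × Ω, (√(μ x.2) * E x.1 x.2) ^ 2 ≤ 1 := by
    rw [Fintype.sum_prod_type_right]
    calc ∑ ω, ∑ a, (√(μ ω) * E a ω) ^ 2 = ∑ ω, μ ω * ∑ a, E a ω := by
          refine Finset.sum_congr rfl fun ω _ => ?_
          rw [Finset.mul_sum]
          refine Finset.sum_congr rfl fun a _ => ?_
          rw [mul_pow, Real.sq_sqrt (hμ ω).le, hEE]
      _ ≤ ∑ ω, μ ω := Finset.sum_le_sum fun ω _ =>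
          mul_le_of_le_one_right (hμ ω).le (hdisj ω)
      _ = 1 := hμ1
  have e4 : (m : ℝ) * (1 / 2) < ∑ a, ∑ ω, ν a ω * E a ω := by
    calc (m : ℝ) * (1 / 2) = ∑ _a : Fin m, (1 / 2 : ℝ) := by simp
      _ < _ := Finset.sum_lt_sum_of_nonempty ⟨⟨0, hm⟩, Finset.mem_univ _⟩ fun a _ => hmass a
  have hm' : (0 : ℝ) < m := by exact_mod_cast hm
  have h0 : 0 ≤ ∑ x : Fin m × Ω, (ν x.1 x.2 / √(μ x.2)) ^ 2 :=
    Finset.sum_nonneg fun _ _ => sq_nonneg _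
  rw [e1] at hCS
  have e5 : (∑ a, ∑ ω, ν a ω * E a ω) ^ 2 ≤ m * B :=
    hCS.trans ((mul_le_of_le_one_right h0 e3).trans e2)
  nlinarith

/-! ### Likelihoods of the random graph -/

theorem sum_prod_bool {E : Type*} [Fintype E] [DecidableEq E] (f : E → Bool → ℝ) :
    ∑ a : E → Bool, ∏ e, f e (a e) = ∏ e, (f e true + f e false) := by
  have := Finset.prod_univ_sum (fun _ : E => (Finset.univ : Finset Bool)) f
  simpa only [Fintype.piFinset_univ, Fintype.sum_bool] using this.symm

theorem sum_graphProb {n : ℕ} (P : Matrix (Fin n) (Fin n) ℝ) : ∑ a, graphProb P a = 1 := by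
  unfold graphProb
  rw [sum_prod_bool (fun (e : Pairs n) b => if b then P e.1.1 e.1.2 else 1 - P e.1.1 e.1.2)]
  simp

theorem graphProb_nonneg {n : ℕ} {P : Matrix (Fin n) (Fin n) ℝ}
    (h : ∀ i j, 0 ≤ P i j ∧ P i j ≤ 1) (a : Pairs n → Bool) : 0 ≤ graphProb P a := by
  refine Finset.prod_nonneg fun e _ => ?_
  have := h e.1.1 e.1.2
  split_ifs <;> linarith

theorem graphProb_pos {n : ℕ} {P : Matrix (Fin n) (Fin n) ℝ}
    (h : ∀ i j, 0 < P i j ∧ P i j < 1) (a : Pairs n → Bool) : 0 < graphProb P a := by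
  refine Finset.prod_pos fun e _ => ?_
  have := h e.1.1 e.1.2
  split_ifs <;> linarith

/-- The chi-square affinity of two random graphs whose edge probabilities differ little. -/
theorem sum_graphProb_sq_div_le {n : ℕ} {P P₀ : Matrix (Fin n) (Fin n) ℝ}
    (h₀ : ∀ i j, |P₀ i j - 1 / 2| ≤ 1 / 3) (v : Fin n → Fin n → ℝ)
    (hv : ∀ i j, (P i j - P₀ i j) ^ 2 ≤ v i j) :
    ∑ a, graphProb P a ^ 2 / graphProb P₀ a ≤ Real.exp (8 * ∑ i, ∑ j, v i j) := by
  set F : Pairs n → Bool → ℝ := fun e b => (if b then P e.1.1 e.1.2 else 1 - P e.1.1 e.1.2) ^ 2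
    / (if b then P₀ e.1.1 e.1.2 else 1 - P₀ e.1.1 e.1.2) with hF
  have e1 : ∀ a, graphProb P a ^ 2 / graphProb P₀ a = ∏ e : Pairs n, F e (a e) := by
    intro a
    simp only [graphProb, hF]
    rw [← Finset.prod_pow, ← Finset.prod_div_distrib]
  rw [Finset.sum_congr rfl fun a _ => e1 a, sum_prod_bool]
  have hv0 : ∀ i j, 0 ≤ v i j := fun i j => (sq_nonneg _).trans (hv i j)
  calc _ ≤ ∏ e : Pairs n, Real.exp (8 * v e.1.1 e.1.2) := by
        refine Finset.prod_le_prod ?_ ?_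
        · intro e _
          have := abs_le.mp (h₀ e.1.1 e.1.2)
          have h1 : 0 < P₀ e.1.1 e.1.2 := by linarith
          have h2 : 0 < 1 - P₀ e.1.1 e.1.2 := by linarith
          simp only [hF, if_true, Bool.false_eq_true, if_false]
          positivity
        · intro e _
          simp only [hF, if_true, Bool.false_eq_true, if_false]
          have := abs_le.mp (h₀ e.1.1 e.1.2)
          have hh := hv e.1.1 e.1.2
          set x := P₀ e.1.1 e.1.2
          set y := P e.1.1 e.1.2
          have h1 : 0 < x := by linarith
          have h2 : 0 < 1 - x := by linarith
          -- As `|x - 1/2| ≤ 1/3`, the variance is at least `5/36`; this is the source of the factor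
          -- 8.
          have h3 : 1 / 8 ≤ x * (1 - x) := by nlinarith
          have h4 : y ^ 2 / x + (1 - y) ^ 2 / (1 - x) = (y - x) ^ 2 / (x * (1 - x)) + 1 := by
            field_simp
            ring
          rw [h4]
          refine le_trans ?_ (Real.add_one_le_exp _)
          gcongr
          rw [div_le_iff₀ (by positivity)]
          nlinarith [sq_nonneg (y - x)]
    _ = Real.exp (8 * ∑ e : Pairs n, v e.1.1 e.1.2) := by
        rw [← Real.exp_sum, Finset.mul_sum]
    _ ≤ Real.exp (8 * ∑ i, ∑ j, v i j) := by
        -- Passing from pairs `i < j` to all ordered pairs only adds nonnegative terms.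
        gcongr
        rw [← Fintype.sum_prod_type' (f := v),
          ← Finset.sum_subtype (Finset.univ.filter fun e : Fin n × Fin n => e.1 < e.2)
            (by simp) (fun e : Fin n × Fin n => v e.1 e.2)]
        exact Finset.sum_le_sum_of_subset_of_nonneg (Finset.filter_subset _ _)
          fun e _ _ => hv0 e.1 e.2

/-! ### Spectral factors -/

/-- Weighted distances of rows agree for all spectral factors of a matrix. -/
theorem IsSpectralFactor.sum_sq_rows {n p q : ℕ} {P : Matrix (Fin n) (Fin n) ℝ}
    {Z : Matrix (Fin n) (Fin p ⊕ Fin q) ℝ} (h : IsSpectralFactor P Z) (i r : Fin n) :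
    ∑ k, (∑ j, Z j k ^ 2) * (Z i k - Z r k) ^ 2 = ∑ j, (P i j - P r j) ^ 2 := by
  obtain ⟨hP, hD⟩ := h
  have hoff : ∀ k l, k ≠ l → ∑ j, Z j k * Z j l = 0 := by
    intro k l hkl
    simpa [Matrix.mul_apply] using hD hkl
  have hdiff : ∀ j, P i j - P r j = ∑ k, (Z i k - Z r k) * sgn k * Z j k := by
    intro j
    rw [hP, signature_form_apply, signature_form_apply, ← Finset.sum_sub_distrib]
    exact Finset.sum_congr rfl fun k _ => by simp only [sgn]; ring
  simp_rw [hdiff, sq (∑ k, _), Finset.sum_mul_sum]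
  rw [Finset.sum_comm]
  refine Finset.sum_congr rfl fun k _ => ?_
  -- Orthogonality of the columns kills the cross terms, and the signs enter only through their
  -- squares.
  rw [Finset.sum_comm, Finset.sum_eq_single k]
  · rw [Finset.sum_mul]
    refine Finset.sum_congr rfl fun j _ => ?_
    linear_combination (-(Z j k ^ 2 * (Z i k - Z r k) ^ 2)) * sgn_sq k
  · intro l _ hl
    calc _ = ((Z i k - Z r k) * sgn k * ((Z i l - Z r l) * sgn l)) * ∑ j, Z j k * Z j l := by
          rw [Finset.mul_sum]
          exact Finset.sum_congr rfl fun j _ => by ring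
      _ = 0 := by rw [hoff k l hl.symm, mul_zero]
  · simp

/-- Rows of a spectral factor coincide where the rows of the matrix do. -/
theorem IsSpectralFactor.row_eq {n p q : ℕ} {P : Matrix (Fin n) (Fin n) ℝ}
    {Z : Matrix (Fin n) (Fin p ⊕ Fin q) ℝ} (h : IsSpectralFactor P Z) {i r : Fin n}
    (hir : ∀ j, P i j = P r j) (k : Fin p ⊕ Fin q) : Z i k = Z r k := by
  have h1 := h.sum_sq_rows i r
  simp only [hir, sub_self, ne_eq, OfNat.ofNat_ne_zero, not_false_eq_true, zero_pow,
    Finset.sum_const_zero] at h1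
  have hnn : ∀ k, 0 ≤ ∑ j, Z j k ^ 2 := fun k => Finset.sum_nonneg fun _ _ => sq_nonneg _
  have h2 := (Finset.sum_eq_zero_iff_of_nonneg
    fun k _ => mul_nonneg (hnn k) (sq_nonneg _)).mp h1 k (Finset.mem_univ _)
  -- A column of weight zero vanishes identically, so its entries agree as well.
  rcases mul_eq_zero.mp h2 with h3 | h3
  · have h4 : ∀ j, Z j k = 0 := fun j => by
      simpa using (Finset.sum_eq_zero_iff_of_nonneg fun _ _ => sq_nonneg _).mp h3 j
        (Finset.mem_univ _)
    rw [h4, h4]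
  · exact sub_eq_zero.mp (pow_eq_zero_iff two_ne_zero |>.mp h3)

/-- A column `z` of squared norm `D` satisfies `zᵀ P z = ± D²`, because `Zᵀ P Z = (Zᵀ Z) I_{p,q} (Zᵀ
Z)` with `Zᵀ Z` diagonal. Entries of `P` bounded by 1 give `D² ≤ (∑ |z_i|)² ≤ n D`. -/
theorem IsSpectralFactor.sum_sq_col_le {n p q : ℕ} {P : Matrix (Fin n) (Fin n) ℝ}
    {Z : Matrix (Fin n) (Fin p ⊕ Fin q) ℝ} (h : IsSpectralFactor P Z)
    (hP1 : ∀ i j, |P i j| ≤ 1) (k : Fin p ⊕ Fin q) : ∑ j, Z j k ^ 2 ≤ n := by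
  obtain ⟨hP, hD⟩ := h
  set D := ∑ j, Z j k ^ 2 with hDdef
  have hD0 : 0 ≤ D := Finset.sum_nonneg fun _ _ => sq_nonneg _
  have hform : ∑ i, ∑ j, Z i k * P i j * Z j k = sgn k * D ^ 2 := by
    have h1 : Z.transpose * P * Z
        = Z.transpose * Z * signature p q * (Z.transpose * Z) := by
      rw [hP]; simp only [Matrix.mul_assoc]
    obtain ⟨μ, hμ⟩ : ∃ μ, Z.transpose * Z = Matrix.diagonal μ :=
      ⟨_, ((Matrix.isDiag_iff_diagonal_diag _).mp hD).symm⟩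
    have hμk : μ k = D := by
      have := congrFun (congrFun hμ k) k
      rw [Matrix.diagonal_apply_eq, Matrix.mul_apply] at this
      rw [← this, hDdef]
      exact Finset.sum_congr rfl fun j _ => by rw [Matrix.transpose_apply]; ring
    have h2 := congrFun (congrFun h1 k) k
    rw [hμ, signature_eq, Matrix.diagonal_mul_diagonal, Matrix.diagonal_mul_diagonal,
      Matrix.diagonal_apply_eq, hμk] at h2
    simp only [Matrix.mul_apply, Matrix.transpose_apply, Finset.sum_mul] at h2
    rw [Finset.sum_comm, h2]
    ring
  have hbound : D ^ 2 ≤ n * D := by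
    calc D ^ 2 = |∑ i, ∑ j, Z i k * P i j * Z j k| := by
          rw [hform, abs_mul, abs_sgn, one_mul, abs_of_nonneg (sq_nonneg _)]
      _ ≤ ∑ i, ∑ j, |Z i k| * |Z j k| := by
          refine (Finset.abs_sum_le_sum_abs _ _).trans (Finset.sum_le_sum fun i _ => ?_)
          refine (Finset.abs_sum_le_sum_abs _ _).trans (Finset.sum_le_sum fun j _ => ?_)
          rw [abs_mul, abs_mul]
          exact mul_le_mul_of_nonneg_right
            (mul_le_of_le_one_right (abs_nonneg _) (hP1 i j)) (abs_nonneg _)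
      _ = (∑ i, |Z i k|) ^ 2 := by rw [sq, Finset.sum_mul_sum]
      _ ≤ n * D := by
          have := sq_sum_le_card_mul_sum_sq (s := (Finset.univ : Finset (Fin n)))
            (f := fun i => |Z i k|)
          simpa using this
  by_contra! hlt
  nlinarith [(Nat.cast_nonneg n : (0 : ℝ) ≤ n)]

/-! ### Eigenvalues -/

/-- `Z (I_{p,q} Zᵀ)` and `(I_{p,q} Zᵀ) Z` have the same characteristic polynomial up to a power of
`X`, and the second product is diagonal. -/
theorem charpoly_roots_of_gram {n p q : ℕ} (hn : p + q ≤ n)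
    (Z : Matrix (Fin n) (Fin p ⊕ Fin q) ℝ) (D : Fin p ⊕ Fin q → ℝ)
    (hZ : Z.transpose * Z = Matrix.diagonal D) :
    (probMatrix Z).charpoly.roots
      = Multiset.replicate (n - (p + q)) 0
        + (Finset.univ : Finset (Fin p ⊕ Fin q)).val.map (fun k => sgn k * D k) := by
  have h1 := Matrix.charpoly_mul_comm_of_le Z (signature p q * Z.transpose) (by simpa using hn)
  rw [Matrix.mul_assoc, hZ, signature_eq, Matrix.diagonal_mul_diagonal,
    Matrix.charpoly_diagonal] at h1
  rw [probMatrix, Matrix.mul_assoc, signature_eq, h1, Polynomial.roots_mul]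
  · congr 1
    · simp [Multiset.nsmul_singleton]
    · rw [Polynomial.roots_prod]
      · simp_rw [Polynomial.roots_X_sub_C, Multiset.bind_singleton]
      · exact Finset.prod_ne_zero_iff.mpr fun k _ => Polynomial.X_sub_C_ne_zero _
  · exact mul_ne_zero (pow_ne_zero _ Polynomial.X_ne_zero)
      (Finset.prod_ne_zero_iff.mpr fun k _ => Polynomial.X_sub_C_ne_zero _)

theorem absEigenvalue_of_gram {n p q : ℕ} (hn : p + q ≤ n) (hd : 2 ≤ p + q)
    (Z : Matrix (Fin n) (Fin p ⊕ Fin q) ℝ) (k₁ : Fin p ⊕ Fin q) {l₁ l : ℝ} (hl : 0 ≤ l)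
    (hl₁ : l ≤ l₁)
    (hZ : Z.transpose * Z = Matrix.diagonal fun k => if k = k₁ then l₁ else l) :
    absEigenvalue (probMatrix Z) 1 = l₁ ∧ absEigenvalue (probMatrix Z) (p + q) = l := by
  have key : ((probMatrix Z).charpoly.roots.map (fun x => |x|)).sort (fun a b => a ≥ b)
      = l₁ :: (List.replicate (p + q - 1) l ++ List.replicate (n - (p + q)) 0) := by
    have hroots : (probMatrix Z).charpoly.roots.map (fun x => |x|)
        = ((l₁ :: (List.replicate (p + q - 1) l ++ List.replicate (n - (p + q)) 0) :
          List ℝ) : Multiset ℝ) := by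
      rw [charpoly_roots_of_gram hn Z _ hZ, Multiset.map_add, Multiset.map_map]
      have e1 : (Finset.univ : Finset (Fin p ⊕ Fin q)).val.map
          ((fun x : ℝ => |x|) ∘ fun k => sgn k * if k = k₁ then l₁ else l)
          = l₁ ::ₘ Multiset.replicate (p + q - 1) l := by
        rw [← Finset.insert_erase (Finset.mem_univ k₁),
          Finset.insert_val_of_notMem (Finset.notMem_erase _ _), Multiset.map_cons]
        congr 1
        · simp [abs_mul, abs_sgn, abs_of_nonneg (hl.trans hl₁)]
        · rw [Multiset.eq_replicate]
          constructor
          · simp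
          · intro b hb
            obtain ⟨k, hk, rfl⟩ := Multiset.mem_map.mp hb
            have : k ≠ k₁ := Finset.ne_of_mem_erase (Finset.mem_val.mp hk)
            simp [abs_mul, abs_sgn, this, abs_of_nonneg hl]
      rw [e1]
      simp only [Multiset.map_replicate, abs_zero, ← Multiset.cons_coe, ← Multiset.coe_add,
        Multiset.coe_replicate]
      rw [Multiset.add_cons, add_comm]
    rw [hroots, Multiset.coe_sort]
    refine List.mergeSort_of_pairwise ?_
    simp only [decide_eq_true_eq, List.pairwise_cons, List.mem_append, List.mem_replicate,
      List.pairwise_append, List.pairwise_replicate]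
    refine ⟨?_, Or.inr le_rfl, Or.inr le_rfl, ?_⟩
    · rintro b (⟨_, rfl⟩ | ⟨_, rfl⟩)
      · exact hl₁
      · exact hl.trans hl₁
    · rintro a ⟨_, rfl⟩ b ⟨_, rfl⟩
      exact hl
  constructor
  · simp [absEigenvalue, key]
  -- Index `p + q - 1` in the sorted list, counted from zero, is the last copy of `l`; `2 ≤ p + q`
  -- ensures that there is one.
  · obtain ⟨d, hd'⟩ : ∃ d, p + q = d + 2 := ⟨p + q - 2, by omega⟩
    rw [absEigenvalue, key, hd']
    simp

/-! ### The least favourable latent positions -/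

/-- Labels of the vertices: `2m` of them for each column, and `r` remaining ones. -/
abbrev VertexLabel (p q m r : ℕ) : Type := ((Fin p ⊕ Fin q) × Fin m × Bool) ⊕ Fin r

/-- The magnitude of the `k`-th coordinate of the latent position of a labelled vertex: it is `t k`
on the block of column `k`, and `δ` in column `k₂` for the two vertices `(k₁, a, ·)`. -/
noncomputable def height {p q m : ℕ} (k₁ k₂ : Fin p ⊕ Fin q) (t : Fin p ⊕ Fin q → ℝ) (δ : ℝ)
    (a : Fin m) (k k' : Fin p ⊕ Fin q) (a' : Fin m) : ℝ :=
  if k = k₁ then 0 else if k' = k then t k else if k' = k₁ ∧ k = k₂ ∧ a' = a then δ else 0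

/-- The coordinates of the latent positions outside the constant column `k₁`. -/
noncomputable def profile {p q m r : ℕ} (k₁ k₂ : Fin p ⊕ Fin q) (t : Fin p ⊕ Fin q → ℝ) (δ : ℝ)
    (a : Fin m) (x : VertexLabel p q m r) (k : Fin p ⊕ Fin q) : ℝ :=
  Sum.elim (fun y => (if y.2.2 then 1 else -1) * height k₁ k₂ t δ a k y.1 y.2.1) (fun _ => 0) x

/-- The least favourable latent positions: the column `k₁` is constant. -/
noncomputable def hardPositions {n p q m r : ℕ} (e : Fin n ≃ VertexLabel p q m r)
    (k₁ k₂ : Fin p ⊕ Fin q) (t : Fin p ⊕ Fin q → ℝ) (δ : ℝ) (a : Fin m) :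
    Matrix (Fin n) (Fin p ⊕ Fin q) ℝ :=
  fun i k => if k = k₁ then √(1 / 2) else profile k₁ k₂ t δ a (e i) k

variable {n p q m r : ℕ} (e : Fin n ≃ VertexLabel p q m r) {k₁ k₂ : Fin p ⊕ Fin q}
  (t : Fin p ⊕ Fin q → ℝ) (δ : ℝ) (a : Fin m)

theorem sum_vertexLabel (f : VertexLabel p q m r → ℝ) :
    ∑ x, f x = ∑ k, ∑ a, (f (Sum.inl (k, a, true)) + f (Sum.inl (k, a, false)))
      + ∑ x, f (Sum.inr x) := by
  rw [Fintype.sum_sum_type, Fintype.sum_prod_type]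
  simp_rw [Fintype.sum_prod_type, Fintype.sum_bool]

theorem profile_self (x : VertexLabel p q m r) : profile k₁ k₂ t δ a x k₁ = 0 := by
  rcases x with x | x <;> simp [profile, height]

theorem hardPositions_const (i : Fin n) :
    hardPositions e k₁ k₂ t δ a i k₁ = √(1 / 2) := by simp [hardPositions]

theorem hardPositions_of_ne {k : Fin p ⊕ Fin q} (hk : k ≠ k₁) (i : Fin n) :
    hardPositions e k₁ k₂ t δ a i k = profile k₁ k₂ t δ a (e i) k := by
  simp [hardPositions, hk]

/-- The two signs cancel. This makes the column orthogonal to the constant one. -/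
theorem sum_profile (k : Fin p ⊕ Fin q) :
    ∑ x : VertexLabel p q m r, profile k₁ k₂ t δ a x k = 0 := by
  simp [profile, Fintype.sum_sum_type, Fintype.sum_prod_type]

/-- The columns have disjoint supports: on the block of `k₁` only column `k₂` can be nonzero, and on
any other block only the column owning it. -/
theorem height_mul_height {k l : Fin p ⊕ Fin q} (hkl : k ≠ l) (k' : Fin p ⊕ Fin q)
    (a' : Fin m) : height k₁ k₂ t δ a k k' a' * height k₁ k₂ t δ a l k' a' = 0 := by
  unfold height
  split_ifs <;> first | (exfalso; grind) | simp

theorem profile_mul_profile {k l : Fin p ⊕ Fin q} (hkl : k ≠ l) (x : VertexLabel p q m r) :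
    profile k₁ k₂ t δ a x k * profile k₁ k₂ t δ a x l = 0 := by
  rcases x with ⟨k', a', b⟩ | x
  · simp only [profile, Sum.elim_inl]
    rw [mul_mul_mul_comm, height_mul_height t δ a hkl, mul_zero]
  · simp [profile]

theorem sum_profile_sq {k : Fin p ⊕ Fin q} (hk : k ≠ k₁) :
    ∑ x : VertexLabel p q m r, profile k₁ k₂ t δ a x k ^ 2
      = 2 * m * t k ^ 2 + if k = k₂ then 2 * δ ^ 2 else 0 := by
  have h1 : ∀ (k' : Fin p ⊕ Fin q) (a' : Fin m), height k₁ k₂ t δ a k k' a' ^ 2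
      = (if k' = k then t k ^ 2 else 0)
        + if k' = k₁ then (if a' = a then (if k = k₂ then δ ^ 2 else 0) else 0) else 0 := by
    intro k' a'
    unfold height
    split_ifs <;> first | (exfalso; grind) | simp
  simp only [profile, sum_vertexLabel, Sum.elim_inl, Sum.elim_inr, if_true, Bool.false_eq_true, if_false, mul_pow, one_mul, neg_one_sq,
    h1]
  simp only [Finset.sum_add_distrib, Finset.sum_ite_irrel, Finset.sum_ite_eq', Finset.mem_univ,
    if_true, Finset.sum_const_zero, Finset.sum_const, Finset.card_univ, Fintype.card_fin,
    nsmul_eq_mul]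
  split_ifs <;> simp <;> ring

/-- Each vertex has at most one nonzero coordinate outside the constant column. -/
theorem profile_sq_sum_le {M : ℝ} (hM : 0 ≤ M) (ht : ∀ k, k ≠ k₁ → t k ^ 2 ≤ M)
    (hδ : δ ^ 2 ≤ M)
    (x : VertexLabel p q m r) : ∑ k, profile k₁ k₂ t δ a x k ^ 2 ≤ M := by
  rcases x with ⟨k', a', b⟩ | x
  · have hb : (if b then (1 : ℝ) else -1) ^ 2 = 1 := by cases b <;> simp
    simp only [profile, Sum.elim_inl, mul_pow, hb, one_mul]
    by_cases hk' : k' = k₁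
    · rw [Finset.sum_eq_single k₂]
      · unfold height
        split_ifs with h1 h2 h3
        · simpa using hM
        · exact absurd (h2.symm.trans hk') h1
        · exact hδ
        · simpa using hM
      · intro k _ hk
        unfold height
        split_ifs with h1 h2 h3
        · simp
        · exact absurd (h2.symm.trans hk') h1
        · exact absurd h3.2.1 hk
        · simp
      · simp
    · rw [Finset.sum_eq_single k']
      · simpa [height, hk'] using ht k' hk'
      · intro k _ hk
        simp [height, hk', hk.symm]
      · simp
  · simpa [profile] using hM

theorem gram_hardPositions {l₁ l : ℝ} (hl₁ : l₁ = n / 2)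
    (hl : ∀ k, k ≠ k₁ → 2 * m * t k ^ 2 + (if k = k₂ then 2 * δ ^ 2 else 0) = l) :
    (hardPositions e k₁ k₂ t δ a).transpose * hardPositions e k₁ k₂ t δ a
      = Matrix.diagonal fun k => if k = k₁ then l₁ else l := by
  have hsum : ∀ f : VertexLabel p q m r → ℝ, ∑ i, f (e i) = ∑ x, f x := fun f => Equiv.sum_comp e f
  have hmix : ∀ k, k ≠ k₁ →
      ∑ i, hardPositions e k₁ k₂ t δ a i k₁ * hardPositions e k₁ k₂ t δ a i k = 0 := by
    intro k hk
    simp_rw [hardPositions_const, hardPositions_of_ne e t δ a hk]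
    rw [← Finset.mul_sum, hsum (fun x => profile k₁ k₂ t δ a x k), sum_profile, mul_zero]
  ext k k'
  rw [Matrix.mul_apply, Matrix.diagonal_apply]
  simp only [Matrix.transpose_apply]
  split_ifs with h1 h2
  · subst h1 h2
    simp_rw [hardPositions_const]
    rw [Real.mul_self_sqrt (by norm_num)]
    simp [hl₁, div_eq_mul_inv]
  · subst h1
    simp_rw [hardPositions_of_ne e t δ a h2, ← sq]
    rw [hsum (fun x => profile k₁ k₂ t δ a x k ^ 2), sum_profile_sq t δ a h2, hl k h2]
  · by_cases hk : k = k₁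
    · subst hk
      exact hmix k' (Ne.symm h1)
    by_cases hk' : k' = k₁
    · subst hk'
      simp_rw [mul_comm (hardPositions e k' k₂ t δ a _ k)]
      exact hmix k h1
    simp_rw [hardPositions_of_ne e t δ a hk, hardPositions_of_ne e t δ a hk',
      profile_mul_profile t δ a h1]
    simp

theorem isSpectralFactor_hardPositions {l : ℝ}
    (hl : ∀ k, k ≠ k₁ → 2 * m * t k ^ 2 + (if k = k₂ then 2 * δ ^ 2 else 0) = l) :
    IsSpectralFactor (probMatrix (hardPositions e k₁ k₂ t δ a)) (hardPositions e k₁ k₂ t δ a) := by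
  refine ⟨rfl, ?_⟩
  rw [gram_hardPositions e t δ a rfl hl]
  exact Matrix.isDiag_diagonal _

theorem probMatrix_hardPositions (hk₁ : sgn k₁ = 1) (i j : Fin n) :
    probMatrix (hardPositions e k₁ k₂ t δ a) i j
      = 1 / 2 + ∑ k, profile k₁ k₂ t δ a (e i) k * sgn k * profile k₁ k₂ t δ a (e j) k := by
  rw [probMatrix_apply, ← Finset.add_sum_erase _ _ (Finset.mem_univ k₁),
    ← Finset.add_sum_erase (a := k₁) _
      (fun k => profile k₁ k₂ t δ a (e i) k * sgn k * profile k₁ k₂ t δ a (e j) k)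
      (Finset.mem_univ k₁)]
  simp only [hardPositions_const, profile_self, hk₁, mul_one, zero_mul, zero_add]
  rw [Real.mul_self_sqrt (by norm_num)]
  congr 1
  refine Finset.sum_congr rfl fun k hk => ?_
  have hk := Finset.ne_of_mem_erase hk
  rw [hardPositions_of_ne e t δ a hk, hardPositions_of_ne e t δ a hk]

/-- The constant column contributes exactly `1/2`; the rest is bounded by the arithmetic–geometric
mean inequality and the bound on row norms. -/
theorem abs_probMatrix_hardPositions_sub_le (hk₁ : sgn k₁ = 1) {M : ℝ} (hM : 0 ≤ M)
    (ht : ∀ k, k ≠ k₁ → t k ^ 2 ≤ M) (hδ : δ ^ 2 ≤ M) (i j : Fin n) :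
    |probMatrix (hardPositions e k₁ k₂ t δ a) i j - 1 / 2| ≤ M := by
  rw [probMatrix_hardPositions e t δ a hk₁, add_sub_cancel_left]
  calc _ ≤ ∑ k, |profile k₁ k₂ t δ a (e i) k * sgn k * profile k₁ k₂ t δ a (e j) k| :=
        Finset.abs_sum_le_sum_abs _ _
    _ ≤ ∑ k, (profile k₁ k₂ t δ a (e i) k ^ 2 + profile k₁ k₂ t δ a (e j) k ^ 2) / 2 := by
        refine Finset.sum_le_sum fun k _ => ?_
        rw [abs_mul, abs_mul, abs_sgn, mul_one]
        have := two_mul_le_add_sq |profile k₁ k₂ t δ a (e i) k| |profile k₁ k₂ t δ a (e j) k|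
        rw [sq_abs, sq_abs] at this
        linarith
    _ ≤ M := by
        rw [← Finset.sum_div, Finset.sum_add_distrib]
        have h1 := profile_sq_sum_le (k₂ := k₂) t δ a hM ht hδ (e i)
        have h2 := profile_sq_sum_le (k₂ := k₂) t δ a hM ht hδ (e j)
        linarith

/-! ### The effect of the hidden pair on the edge probabilities -/

/-- The indicator of the two perturbed vertices. -/
noncomputable def perturbed (k₁ : Fin p ⊕ Fin q) (a : Fin m) (x : VertexLabel p q m r) : ℝ :=
  Sum.elim (fun y => if y.1 = k₁ then (if y.2.1 = a then 1 else 0) else 0) (fun _ => 0) x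

theorem sum_perturbed (k₁ : Fin p ⊕ Fin q) (a : Fin m) :
    ∑ x : VertexLabel p q m r, perturbed k₁ a x = 2 := by
  simp only [perturbed, sum_vertexLabel, Sum.elim_inl, Sum.elim_inr]
  simp only [Finset.sum_add_distrib, Finset.sum_ite_irrel, Finset.sum_ite_eq', Finset.mem_univ,
    if_true, Finset.sum_const_zero]
  norm_num

theorem profile_eq_of_perturbed_eq_zero {x : VertexLabel p q m r} (hx : perturbed k₁ a x = 0)
    (k : Fin p ⊕ Fin q) : profile k₁ k₂ t δ a x k = profile k₁ k₂ t 0 a x k := by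
  rcases x with ⟨k', a', b⟩ | x
  · simp only [profile, Sum.elim_inl]
    congr 1
    simp only [perturbed, Sum.elim_inl] at hx
    unfold height
    split_ifs with h1 h2 h3
    · rfl
    · rfl
    · simp [h3.1, h3.2.2] at hx
    · rfl
  · simp [profile]

theorem perturbed_eq_zero_or (x : VertexLabel p q m r) :
    perturbed k₁ a x = 0 ∨ (perturbed k₁ a x = 1 ∧ |profile k₁ k₂ t δ a x k₂| ≤ |δ|
      ∧ profile k₁ k₂ t 0 a x k₂ = 0) := by
  rcases x with ⟨k', a', b⟩ | x
  · by_cases h1 : k' = k₁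
    · by_cases h2 : a' = a
      · right
        have hb : |(if b then (1 : ℝ) else -1)| = 1 := by cases b <;> simp
        refine ⟨by simp [perturbed, h1, h2], ?_, ?_⟩
        · simp only [profile, Sum.elim_inl, abs_mul, hb, one_mul, height]
          split_ifs with h3 h4 h5
          · simp
          · exact absurd (h4.symm.trans h1) h3
          · exact le_rfl
          · simp
        · simp only [profile, Sum.elim_inl, height]
          by_cases h3 : k₂ = k₁
          · simp [h3]
          · simp [h1, h3, Ne.symm h3]
      · left; simp [perturbed, h1, h2]
    · left; simp [perturbed, h1]
  · left; simp [perturbed]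

theorem profile_eq_zero_delta {k : Fin p ⊕ Fin q} (hk : k ≠ k₂) (x : VertexLabel p q m r) :
    profile k₁ k₂ t δ a x k = profile k₁ k₂ t 0 a x k := by
  rcases x with ⟨k', a', b⟩ | x <;> simp [profile, height, hk]

/-- Only column `k₂` changes, and only on rows and columns of `P` indexed by the hidden pair. There
the unperturbed product is zero, and the perturbed one is at most `|δ|` times a coordinate of size
at most 1. -/
theorem probMatrix_hardPositions_sub_sq_le (hk₁ : sgn k₁ = 1)
    (ht : ∀ k, k ≠ k₁ → t k ^ 2 ≤ 1) (hδ : δ ^ 2 ≤ 1) (i j : Fin n) :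
    (probMatrix (hardPositions e k₁ k₂ t δ a) i j - probMatrix (hardPositions e k₁ k₂ t 0 a) i j)
      ^ 2 ≤ δ ^ 2 * (perturbed k₁ a (e i) + perturbed k₁ a (e j)) := by
  have h1 : probMatrix (hardPositions e k₁ k₂ t δ a) i j
      - probMatrix (hardPositions e k₁ k₂ t 0 a) i j
      = sgn k₂ * (profile k₁ k₂ t δ a (e i) k₂ * profile k₁ k₂ t δ a (e j) k₂
        - profile k₁ k₂ t 0 a (e i) k₂ * profile k₁ k₂ t 0 a (e j) k₂) := by
    rw [probMatrix_hardPositions e t δ a hk₁, probMatrix_hardPositions e t 0 a hk₁,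
      add_sub_add_left_eq_sub, ← Finset.sum_sub_distrib, Finset.sum_eq_single k₂]
    · ring
    · intro k _ hk
      rw [profile_eq_zero_delta t δ a hk, profile_eq_zero_delta t δ a hk, sub_self]
    · simp
  have hle : ∀ x : VertexLabel p q m r, profile k₁ k₂ t δ a x k₂ ^ 2 ≤ 1 := fun x =>
    (Finset.single_le_sum (f := fun k => profile k₁ k₂ t δ a x k ^ 2)
      (fun _ _ => sq_nonneg _) (Finset.mem_univ k₂)).trans
      (profile_sq_sum_le t δ a zero_le_one ht hδ x)
  have hnn : ∀ x : VertexLabel p q m r, 0 ≤ perturbed k₁ a x := by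
    intro x
    rcases perturbed_eq_zero_or (k₁ := k₁) (k₂ := k₂) t δ a x with h | h
    · exact h.ge
    · rw [h.1]; exact zero_le_one
  rw [h1, mul_pow, sgn_sq, one_mul]
  rcases perturbed_eq_zero_or (k₁ := k₁) (k₂ := k₂) t δ a (e i) with hi | ⟨hi, hi', hi0⟩
  · rcases perturbed_eq_zero_or (k₁ := k₁) (k₂ := k₂) t δ a (e j) with hj | ⟨hj, hj', hj0⟩
    · rw [profile_eq_of_perturbed_eq_zero t δ a hi, profile_eq_of_perturbed_eq_zero t δ a hj, hi,
        hj]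
      simp
    · rw [hj0, hj, hi]
      have := sq_le_sq.mpr hj'
      nlinarith [hle (e i), sq_nonneg (profile k₁ k₂ t δ a (e j) k₂)]
  · rw [hi0, hi]
    have := sq_le_sq.mpr hi'
    have h3 := mul_nonneg (sq_nonneg δ) (hnn (e j))
    nlinarith [hle (e j), sq_nonneg (profile k₁ k₂ t δ a (e i) k₂)]

theorem sum_sum_perturbed :
    ∑ i, ∑ j, δ ^ 2 * (perturbed k₁ a (e i) + perturbed k₁ a (e j)) = 4 * n * δ ^ 2 := by
  have h : ∑ i, perturbed k₁ a (e i) = 2 :=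
    (Equiv.sum_comp e (perturbed k₁ a)).trans (sum_perturbed k₁ a)
  simp_rw [← Finset.mul_sum, Finset.sum_add_distrib, h]
  simp only [Finset.sum_const, Finset.card_univ, Fintype.card_fin, nsmul_eq_mul,
    ← Finset.mul_sum, h]
  ring

/-! ### The distance between classes -/

theorem latentDist_nonneg (X Y : Matrix (Fin n) (Fin p ⊕ Fin q) ℝ) :
    0 ≤ latentDist (latentClass X) (latentClass Y) :=
  Real.iInf_nonneg fun _ => Real.iSup_nonneg fun _ => Real.sqrt_nonneg _

theorem exists_of_latentDist_lt {X Y : Matrix (Fin n) (Fin p ⊕ Fin q) ℝ} {ε : ℝ}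
    (h : latentDist (latentClass X) (latentClass Y) < ε) :
    ∃ W ∈ orthoGroup p q, ∀ i, √(∑ k, (spectralRep X i k - (spectralRep Y * W) i k) ^ 2) < ε := by
  have : Nonempty (orthoGroup p q) := ⟨⟨1, one_mem _, indefOrthogonal_one p q⟩⟩
  obtain ⟨W, hW⟩ := exists_lt_of_ciInf_lt (show (⨅ W : orthoGroup p q,
    twoInftyNorm (spectralRep X - spectralRep Y * W.1)) < ε from h)
  refine ⟨W.1, W.2, fun i => lt_of_le_of_lt ?_ hW⟩
  exact le_ciSup (f := fun i => √(∑ k, (spectralRep X - spectralRep Y * W.1) i k ^ 2))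
    (Set.finite_range _).bddAbove i

/-- Without the hidden pair the label is irrelevant, so a single reference graph serves all
hypotheses. -/
theorem hardPositions_zero (a b : Fin m) :
    hardPositions e k₁ k₂ t 0 a = hardPositions e k₁ k₂ t 0 b := by
  ext i k
  unfold hardPositions profile
  rcases e i with x | x <;> simp [height]

theorem hardPositions_block (a c : Fin m) (k : Fin p ⊕ Fin q) :
    hardPositions e k₁ k₂ t δ a (e.symm (Sum.inl (k₁, c, true))) k
      = if k = k₁ then √(1 / 2) else if k = k₂ ∧ c = a then δ else 0 := by
  unfold hardPositions
  by_cases hk : k = k₁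
  · simp [hk]
  · simp [hk, profile, height, Ne.symm hk]

theorem sum_sq_vecMul_of_orthogonal {W : Matrix (Fin p ⊕ Fin q) (Fin p ⊕ Fin q) ℝ}
    (hW : W ∈ Matrix.orthogonalGroup (Fin p ⊕ Fin q) ℝ) (u : Fin p ⊕ Fin q → ℝ) :
    ∑ k, (Matrix.vecMul u W k) ^ 2 = ∑ k, u k ^ 2 := by
  have h1 : W * W.transpose = 1 := by
    simpa [Matrix.star_eq_conjTranspose] using (Matrix.mem_orthogonalGroup_iff _ _).mp hW
  have h2 : ∀ v : Fin p ⊕ Fin q → ℝ, ∑ k, v k ^ 2 = v ⬝ᵥ v := fun v =>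
    Finset.sum_congr rfl fun k _ => sq _
  rw [h2, h2, ← Matrix.dotProduct_mulVec, Matrix.mulVec_vecMul, h1, Matrix.one_mulVec]

/-- No matrix is close to the classes of two different least favourable latent positions. -/
theorem latentDist_separation (hm : 3 ≤ m) (hk : k₂ ≠ k₁) {l ε : ℝ}
    (hl : ∀ k, k ≠ k₁ → 2 * m * t k ^ 2 + (if k = k₂ then 2 * δ ^ 2 else 0) = l)
    (hP : ∀ a i j, |probMatrix (hardPositions e k₁ k₂ t δ a) i j| ≤ 1)
    (hε : 16 * ε ^ 2 * n ≤ l * δ ^ 2) (hn : 0 < n) {a b : Fin m} (hab : a ≠ b)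
    (Y : Matrix (Fin n) (Fin p ⊕ Fin q) ℝ)
    (ha : latentDist (latentClass Y) (latentClass (hardPositions e k₁ k₂ t δ a)) < ε)
    (hb : latentDist (latentClass Y) (latentClass (hardPositions e k₁ k₂ t δ b)) < ε) :
    False := by
  -- Vertex `(k₁, c, true)` is empty under both hypotheses and serves as the point of comparison.
  obtain ⟨c, hc⟩ : ∃ c : Fin m, c ∉ ({a, b} : Finset (Fin m)) := by
    by_contra! h
    have h1 := Finset.card_le_card (fun c _ => h c : (Finset.univ : Finset (Fin m)) ⊆ {a, b})
    rw [Finset.card_univ, Fintype.card_fin] at h1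
    have := Finset.card_le_two (a := a) (b := b)
    omega
  simp only [Finset.mem_insert, Finset.mem_singleton, not_or] at hc
  obtain ⟨hca, hcb⟩ := hc
  obtain ⟨W, hW, hWr⟩ := exists_of_latentDist_lt ha
  obtain ⟨V, -, hVr⟩ := exists_of_latentDist_lt hb
  set i := e.symm (Sum.inl (k₁, a, true)) with hi
  set r := e.symm (Sum.inl (k₁, c, true)) with hr
  set Xa := hardPositions e k₁ k₂ t δ a with hXa
  set Xb := hardPositions e k₁ k₂ t δ b with hXb
  have hb_rows : ∀ k, spectralRep Xb i k = spectralRep Xb r k := by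
    refine (spectralRep_spec Xb).row_eq fun j => ?_
    rw [probMatrix_apply, probMatrix_apply]
    refine Finset.sum_congr rfl fun k _ => ?_
    rw [hXb, hi, hr, hardPositions_block, hardPositions_block]
    simp [hab, hcb]
  have hb_rows' : ∀ k, (spectralRep Xb * V) i k = (spectralRep Xb * V) r k := by
    intro k
    simp only [Matrix.mul_apply, hb_rows]
  -- The weighted row distance is computed in the factor `Xa` itself, where the two rows differ only
  -- in column `k₂`, of squared norm `l`.
  have ha_rows : l * δ ^ 2
      = ∑ k, (∑ j, spectralRep Xa j k ^ 2) * (spectralRep Xa i k - spectralRep Xa r k) ^ 2 := by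
    rw [(spectralRep_spec Xa).sum_sq_rows i r,
      ← (isSpectralFactor_hardPositions e t δ a hl).sum_sq_rows i r,
      Finset.sum_eq_single k₂]
    · have h1 := congrFun (congrFun (gram_hardPositions e t δ a rfl hl) k₂) k₂
      rw [Matrix.diagonal_apply_eq, if_neg hk, Matrix.mul_apply] at h1
      rw [hi, hr, hardPositions_block, hardPositions_block]
      simp only [hk, hca, if_false, and_true, and_false, if_true, sub_zero]
      rw [← h1]
      congr 1
      exact Finset.sum_congr rfl fun j _ => by rw [Matrix.transpose_apply]; ring
    · intro k _ hk2
      rw [hi, hr, hardPositions_block, hardPositions_block]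
      simp [hk2]
    · simp
  have hle : l * δ ^ 2 ≤ n * ∑ k, (spectralRep Xa i k - spectralRep Xa r k) ^ 2 := by
    rw [ha_rows, Finset.mul_sum]
    exact Finset.sum_le_sum fun k _ => mul_le_mul_of_nonneg_right
      ((spectralRep_spec Xa).sum_sq_col_le (hP a) k) (sq_nonneg _)
  have hrot : ∑ k, (spectralRep Xa i k - spectralRep Xa r k) ^ 2
      = ∑ k, ((spectralRep Xa * W) i k - (spectralRep Xa * W) r k) ^ 2 := by
    rw [← sum_sq_vecMul_of_orthogonal hW.1]
    refine Finset.sum_congr rfl fun k _ => ?_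
    simp only [Matrix.vecMul, dotProduct, Matrix.mul_apply, sub_mul, Finset.sum_sub_distrib]
  have hsq : ∀ f : Fin p ⊕ Fin q → ℝ, √(∑ k, f k ^ 2) < ε → ∑ k, f k ^ 2 < ε ^ 2 := by
    intro f hf
    have h0 := Real.sqrt_nonneg (∑ k, f k ^ 2)
    exact (Real.sqrt_lt' (h0.trans_lt hf)).mp hf
  have s1 := hsq _ (hWr i)
  have s2 := hsq _ (hWr r)
  have s3 := hsq _ (hVr i)
  have s4 := hsq _ (hVr r)
  -- With `v` the common row under `b`, `z - z' = -(y - z) + (y' - z') + (y - v) - (y' - v)`; the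
  -- square of a sum of four terms costs a factor 4.
  have hsum : ∑ k, ((spectralRep Xa * W) i k - (spectralRep Xa * W) r k) ^ 2
      ≤ 4 * (∑ k, (spectralRep Y i k - (spectralRep Xa * W) i k) ^ 2
        + ∑ k, (spectralRep Y r k - (spectralRep Xa * W) r k) ^ 2
        + ∑ k, (spectralRep Y i k - (spectralRep Xb * V) i k) ^ 2
        + ∑ k, (spectralRep Y r k - (spectralRep Xb * V) r k) ^ 2) := by
    rw [← Finset.sum_add_distrib, ← Finset.sum_add_distrib, ← Finset.sum_add_distrib,
      Finset.mul_sum]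
    refine Finset.sum_le_sum fun k _ => ?_
    rw [← hb_rows' k]
    set y := spectralRep Y i k
    set y' := spectralRep Y r k
    set z := (spectralRep Xa * W) i k
    set z' := (spectralRep Xa * W) r k
    set v := (spectralRep Xb * V) i k
    nlinarith [sq_nonneg ((y - z) + (y' - z')), sq_nonneg ((y - z) + (y - v)),
      sq_nonneg ((y - z) - (y' - v)), sq_nonneg ((y' - z') - (y - v)),
      sq_nonneg ((y' - z') + (y' - v)), sq_nonneg ((y - v) + (y' - v))]
  rw [hrot] at hle
  have hn' : (0 : ℝ) < n := by exact_mod_cast hn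
  nlinarith

end GRDPG

/-! ### Choice of parameters and conclusion -/

open GRDPG in
/-- The risk over the smallest parameter class, in which `λ_d` is of the order `n`. -/
theorem exists_risk_ge (p q : ℕ) (hp : 1 ≤ p) (hd : 2 ≤ p + q) {n : ℕ}
    (hn : (16 * (p + q)) ^ 2 ≤ n) {K lam : ℝ} (hK : 2 * ((p + q : ℕ) : ℝ) ≤ K)
    (hlam : 3 * (2 * ((p + q : ℕ) : ℝ)) * lam ≤ (n : ℝ))
    (Xhat : Matrix (Fin n) (Fin n) ℕ → Matrix (Fin n) (Fin p ⊕ Fin q) ℝ) :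
    ∃ X ∈ parameterClass n p q K lam,
      1 / (128 * √((p + q : ℕ) : ℝ)) * √(Real.log n / n)
        ≤ graphExpectation X fun A => latentDist (latentClass (Xhat A)) (latentClass X) := by
  obtain ⟨d, hdd⟩ : ∃ d, d = p + q := ⟨_, rfl⟩
  rw [← hdd] at hn hK hlam hd
  rw [← hdd]
  have hd2 : (2 : ℝ) ≤ d := by exact_mod_cast hd
  have hn1 : (16 * d : ℝ) ^ 2 ≤ n := by exact_mod_cast hn
  have hn1024 : (1024 : ℝ) ≤ n := by nlinarith
  have hn0 : (0 : ℝ) < n := by linarith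
  have hnd : 512 * (d : ℝ) ≤ n := by nlinarith
  -- the block length
  set m := n / (2 * d) with hmdef
  have hm1 : (n : ℝ) < 2 * d * (m + 1) := by
    have := Nat.lt_mul_div_succ n (show 0 < 2 * d by omega)
    exact_mod_cast this
  have hmn : d * (m * 2) ≤ n := by
    have := Nat.div_mul_le_self n (2 * d)
    calc d * (m * 2) = m * (2 * d) := by ring
      _ ≤ n := this
  -- Rounding in `m` loses at most a quarter. This yields both `4 * s ≤ m` and `l / (2 * m) ≤ 1 /
  -- 3`.
  have hm2 : 3 * (n : ℝ) ≤ 8 * d * m := by nlinarith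
  set s := √(n : ℝ) with hs
  have hss : s * s = n := Real.mul_self_sqrt hn0.le
  have hsd : 16 * (d : ℝ) ≤ s := Real.le_sqrt_of_sq_le hn1
  have hms : 4 * s ≤ m := by
    have : 48 * (d : ℝ) * s ≤ 8 * d * m := by nlinarith
    nlinarith
  have hm3' : (3 : ℝ) ≤ m := by linarith
  have hm3 : 3 ≤ m := by exact_mod_cast hm3'
  have hm0 : (0 : ℝ) < m := by linarith
  -- the perturbation
  have hlog0 : 0 ≤ Real.log n := Real.log_nonneg (by linarith)
  have hlogn : Real.log n ≤ n := (Real.log_le_sub_one_of_pos hn0).trans (by linarith)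
  -- Chosen so that the chi-square exponent `8 * (4 * n * δ ^ 2)` equals `log n / 2`.
  set δ := √(Real.log n / n) / 8 with hδ
  have hδ2 : δ ^ 2 = Real.log n / n / 64 := by
    rw [hδ, div_pow, Real.sq_sqrt (div_nonneg hlog0 hn0.le)]; norm_num
  have hδ64 : δ ^ 2 ≤ 1 / 64 := by
    have : Real.log n / n ≤ 1 := (div_le_one hn0).mpr hlogn
    rw [hδ2]; linarith
  have hδpos : 0 < δ := div_pos (Real.sqrt_pos.mpr (div_pos (Real.log_pos (by linarith)) hn0))
    (by norm_num)
  -- Then `(n / 2) / l = 2d`, the least condition number allowed, and `lam ≤ n / (6d) ≤ l`.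
  set l : ℝ := n / (4 * d) with hldef
  have hld : l * (4 * d) = n := div_mul_cancel₀ _ (by positivity)
  have hl128 : 128 ≤ l := by
    rw [hldef, le_div_iff₀ (by positivity)]; linarith
  set k₁ : Fin p ⊕ Fin q := Sum.inl ⟨0, hp⟩ with hk₁
  have hsgn : sgn k₁ = 1 := rfl
  obtain ⟨k₂, hk⟩ : ∃ k₂, k₂ ≠ k₁ := by
    have : 1 < Fintype.card (Fin p ⊕ Fin q) := by
      rw [Fintype.card_sum, Fintype.card_fin, Fintype.card_fin]; omega
    exact Fintype.exists_ne_of_one_lt_card this k₁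
  -- The correction in column `k₂` compensates the hidden pair, so that all these columns have
  -- squared norm exactly `l`.
  set t : Fin p ⊕ Fin q → ℝ := fun k => √((l - if k = k₂ then 2 * δ ^ 2 else 0) / (2 * m)) with ht
  have ht0 : ∀ k, t k ^ 2 = (l - if k = k₂ then 2 * δ ^ 2 else 0) / (2 * m) := by
    intro k
    rw [ht]
    refine Real.sq_sqrt (div_nonneg ?_ (by positivity))
    split_ifs <;> linarith
  have htl : ∀ k, k ≠ k₁ → 2 * m * t k ^ 2 + (if k = k₂ then 2 * δ ^ 2 else 0) = l := by
    intro k _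
    rw [ht0, mul_div_cancel₀ _ (by positivity)]
    ring
  have ht3 : ∀ k, k ≠ k₁ → t k ^ 2 ≤ 1 / 3 := by
    intro k _
    have h1 : t k ^ 2 ≤ l / (2 * m) := by
      rw [ht0]
      gcongr
      split_ifs
      · nlinarith [sq_nonneg δ]
      · linarith
    refine h1.trans ?_
    rw [div_le_iff₀ (by positivity)]
    nlinarith
  obtain ⟨e⟩ : Nonempty (Fin n ≃ VertexLabel p q m (n - d * (m * 2))) := by
    rw [← Fintype.card_eq]
    simp only [Fintype.card_sum, Fintype.card_prod, Fintype.card_fin, Fintype.card_bool, ← hdd]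
    omega
  set X : Fin m → Matrix (Fin n) (Fin p ⊕ Fin q) ℝ := fun a => hardPositions e k₁ k₂ t δ a with hX
  have hPX : ∀ a i j, |probMatrix (X a) i j - 1 / 2| ≤ 1 / 3 := fun a i j =>
    abs_probMatrix_hardPositions_sub_le e t δ a hsgn (by norm_num) ht3 (by linarith) i j
  have hclass : ∀ a, X a ∈ parameterClass n p q K lam := by
    intro a
    have hgram := gram_hardPositions e t δ a rfl htl
    have hdn : p + q ≤ n := by
      rw [← hdd]
      have : (d : ℝ) ≤ n := by linarith
      exact_mod_cast this
    obtain ⟨h1, h2⟩ := absEigenvalue_of_gram hdn (hdd ▸ hd) (X a) k₁ (by linarith)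
      (by nlinarith) hgram
    have hcond : condNumber (p + q) (probMatrix (X a)) = 2 * d := by
      rw [condNumber, h1, h2, hldef]
      field_simp
      norm_num
    refine ⟨fun i j => ?_, ?_, ?_, ?_⟩
    · have := abs_le.mp (hPX a i j)
      constructor <;> linarith
    · rw [hcond, hdd]
    · rw [hcond]; exact hK
    · rw [h2, hldef, le_div_iff₀ (by positivity)]
      nlinarith
  have hmpos : 0 < m := by omega
  set a₀ : Fin m := ⟨0, hmpos⟩
  set P₀ := probMatrix (hardPositions e k₁ k₂ t 0 a₀) with hP₀def
  have hP₀ : ∀ i j, |P₀ i j - 1 / 2| ≤ 1 / 3 := fun i j =>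
    abs_probMatrix_hardPositions_sub_le e t 0 a₀ hsgn (by norm_num) ht3 (by norm_num) i j
  have hd0 : (0 : ℝ) < √(d : ℝ) := Real.sqrt_pos.mpr (by linarith)
  -- This gives `16 * ε ^ 2 * n = l * δ ^ 2`, the equality case of the separation condition.
  set ε := δ / (8 * √(d : ℝ)) with hεdef
  have hε : 0 < ε := by positivity
  obtain ⟨a, ha⟩ := exists_large_risk hmpos (graphProb P₀)
    (graphProb_pos fun i j => by
      have := abs_le.mp (hP₀ i j)
      constructor <;> linarith)
    (sum_graphProb P₀) (fun a => graphProb (probMatrix (X a)))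
    (fun a => graphProb_nonneg (hclass a).1) (fun a => sum_graphProb _) (B := s)
    (by
      intro a
      refine (sum_graphProb_sq_div_le hP₀
        (fun i j => δ ^ 2 * (perturbed k₁ a (e i) + perturbed k₁ a (e j))) ?_).trans ?_
      · intro i j
        rw [hP₀def, hardPositions_zero e t a₀ a]
        exact probMatrix_hardPositions_sub_sq_le e t δ a hsgn
          (fun k hk => (ht3 k hk).trans (by norm_num)) (by linarith) i j
      · rw [sum_sum_perturbed, hδ2]
        have : 8 * (4 * n * (Real.log n / n / 64)) = Real.log n / 2 := by
          field_simp
          ring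
        rw [this, Real.exp_half, Real.exp_log hn0])
    hms
    (fun a ω => latentDist (latentClass (Xhat (adjacency ω))) (latentClass (X a)))
    (fun a ω => latentDist_nonneg _ _) hε
    (by
      intro a b hab ω h1 h2
      refine latentDist_separation e t δ hm3 hk htl ?_ (ε := ε) ?_ (by exact_mod_cast hn0) hab
        _ h1 h2
      · intro a i j
        have := abs_le.mp (hPX a i j)
        exact abs_le.mpr ⟨by linarith, by linarith⟩
      · rw [hεdef, div_pow, mul_pow, Real.sq_sqrt (by linarith), hldef]
        apply le_of_eq
        field_simp
        norm_num)
  refine ⟨X a, hclass a, le_trans (le_of_eq ?_) ha⟩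
  rw [hεdef, hδ]
  field_simp
  ring

theorem corollary1 (p q : ℕ) (hp : 1 ≤ p) (hd : 2 ≤ p + q)
    (K : ℝ) (hK : 2 * ((p + q : ℕ) : ℝ) ≤ K) :
    ∃ c : ℝ, 0 < c ∧ ∃ N : ℕ, ∀ n : ℕ, N ≤ n →
      ∀ lam : ℝ, 0 < lam → 3 * (2 * ((p + q : ℕ) : ℝ)) * lam ≤ (n : ℝ) →
        ENNReal.ofReal (c * Real.sqrt (min lam (Real.log n) / n)) ≤
          GRDPG.minimaxRisk (GRDPG.parameterClass n p q K lam) := by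
  have hd0 : (0 : ℝ) < ((p + q : ℕ) : ℝ) := by exact_mod_cast (by omega : 0 < p + q)
  refine ⟨1 / (128 * √((p + q : ℕ) : ℝ)), by positivity, (16 * (p + q)) ^ 2,
    fun n hn lam _ hlam => le_iInf fun Xhat => ?_⟩
  obtain ⟨X, hX, hrisk⟩ := exists_risk_ge p q hp hd hn hK hlam Xhat
  refine le_iSup₂_of_le X hX (ENNReal.ofReal_le_ofReal (le_trans ?_ hrisk))
  gcongr
  -- Only the `log n` side of the minimum is needed.
  exact min_le_right _ _
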